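/- Let $n\ge 1$ and $1<q<\infty$. For a measurable complex-valued or $[0,\infty]$-valued function $g$ on $\mathbb R^n$ let $$Mg(x)=\sup_{P\ni x}\frac1{|P|}\int_P|g(y)|\,dy\in[0,\infty],$$ where the supremum is over all cubes $P\subset\mathbb R^n$ with sides parallel to the axes that contain $x$. For a sequence $f=\{f_j\}_{j=1}^\infty$ of measurable functions $f_j:\mathbb R^n\to\mathbb C$ put $$|f(x)|_q=\Big(\sum_{j=1}^\infty|f_j(x)|^q\Big)^{1/q},\qquad \overline M_qf(x)=\Big(\sum_{j=1}^\infty (Mf_j(x))^q\Big)^{1/q},$$ both with values in $[0,\infty]$. Then there are constants $\alpha,c>0$, depending only on $n$ and $q$, such that for every cube $Q\subset\mathbb R^n$ with sides parallel to the axes, every such sequence $f$ with $\operatorname{supp} f_j\subseteq Q$ for all $j$, and every $t>0$, $$|\{x\in Q:\ \overline M_qf(x)>t\,M(|f|_q)(x)\}|\le c\,e^{-\alpha t^q}\,|Q|.$$ -/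

import Mathlib

open MeasureTheory
open scoped ENNReal

noncomputable section

namespace HardyLittlewood

/-- Cubes of `ℝⁿ`: closed, with sides parallel to the axes and positive side length `l`.
(Using open or half-open cubes instead changes neither the maximal function below, at any point,
nor the measure of a cube.) -/
def IsCube {n : ℕ} (Q : Set (Fin n → ℝ)) : Prop :=
  ∃ (a : Fin n → ℝ) (l : ℝ), 0 < l ∧ Q = Set.Icc a (fun i => a i + l)

/-- The (non-centred) Hardy–Littlewood maximal function
`Mf(x) = sup_{Q ∋ x} |Q|⁻¹ ∫_Q |f(y)| dy`, the supremum being over all cubes `Q` containing `x`.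
It is `[0,∞]`-valued. It applies to `ℂ`-valued functions and also to
`[0,∞]`-valued ones, for which `‖f y‖ₑ = f y`. -/
def maximal {n : ℕ} {ε : Type*} [ENorm ε] (f : (Fin n → ℝ) → ε) (x : Fin n → ℝ) : ℝ≥0∞ :=
  ⨆ (Q : Set (Fin n → ℝ)) (_ : IsCube Q) (_ : x ∈ Q), (∫⁻ y in Q, ‖f y‖ₑ) / volume Q

/-- The pointwise `ℓ^q` norm `|f(x)|_q = (∑_j |f_j(x)|^q)^{1/q}`, with value `∞` where the
series diverges. -/
def lqNorm {n : ℕ} {ε : Type*} [ENorm ε] (q : ℝ) (f : ℕ → (Fin n → ℝ) → ε)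
    (x : Fin n → ℝ) : ℝ≥0∞ :=
  (∑' j, ‖f j x‖ₑ ^ q) ^ (1 / q)

/-- The vector-valued maximal operator
`M̄_q f(x) = (∑_j (M f_j(x))^q)^{1/q}`. -/
def vectorMaximal {n : ℕ} {ε : Type*} [ENorm ε] (q : ℝ) (f : ℕ → (Fin n → ℝ) → ε)
    (x : Fin n → ℝ) : ℝ≥0∞ :=
  (∑' j, maximal (f j) x ^ q) ^ (1 / q)

end HardyLittlewood

end

/-!
For a nested sequence of partitions, let `𝓜_q` be the `ℓ^q`-valued maximal operator of the averages
over their pieces, and let `a` be the average of `|f|_q` over a coarsest piece `P`. Replace each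
`f_j` by its averages over the pieces at the first level where the average of `|f|_q` exceeds `4a`.
The new sequence has `ℓ^q` norm at most a multiple of `a`, by Minkowski's inequality, so the scalar
`L^q` bound summed over `j` controls its maximal operator; and `𝓜_q f` does not see the replacement
off the set where the maximal function of `|f|_q` exceeds `4a`, which the weak type `(1,1)`
inequality controls. Hence `(𝓜_q f)^q > Λ a^q` on at most half of `P`.

Applied inside each piece at which `(𝓜_q f)^q`, restricted to the levels seen so far, first exceeds
`Λ a^q`, this iterates: all averages of `|f|_q` are at most `H = M(|f|_q)`, so `(𝓜_q f)^q > m Λ H^q`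
on at most a `2^{-m}` fraction of `P`. Taking `m` proportional to `t^q` gives the exponential decay.

On `Q`, the functions `M f_j` are dominated by `6^n` times the largest of `2^n` dyadic maximal
functions: shifting a dyadic grid by a third of its coarsest side in some of the coordinates puts
every small cube inside a comparable dyadic one.
-/

noncomputable section

namespace HardyLittlewood

section Integration

variable {X : Type*} [MeasurableSpace X] {ν : Measure X}

lemma lintegral_Ioi_rpow_eq_top (s : ℝ) :
    ∫⁻ t in Set.Ioi (0 : ℝ), ENNReal.ofReal (t ^ s) = ∞ := by
  by_contra h
  have hm : AEStronglyMeasurable (fun t : ℝ => t ^ s) (volume.restrict (Set.Ioi 0)) := by fun_prop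
  refine not_integrableOn_Ioi_rpow s ((lintegral_ofReal_ne_top_iff_integrable hm ?_).1 h)
  filter_upwards [ae_restrict_mem measurableSet_Ioi] with t ht using Real.rpow_nonneg ht.le s

lemma lintegral_rpow_eq_lintegral_measure_lt_mul {f : X → ℝ≥0∞} (hf : AEMeasurable f ν)
    {p : ℝ} (hp : 0 < p) :
    ∫⁻ x, f x ^ p ∂ν = ENNReal.ofReal p *
      ∫⁻ t in Set.Ioi 0, ν {x | ENNReal.ofReal t < f x} * ENNReal.ofReal (t ^ (p - 1)) := by
  by_cases hfin : ∀ᵐ x ∂ν, f x ≠ ∞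
  · calc ∫⁻ x, f x ^ p ∂ν = ∫⁻ x, ENNReal.ofReal ((f x).toReal ^ p) ∂ν := by
          refine lintegral_congr_ae ?_
          filter_upwards [hfin] with x hx
          rw [← ENNReal.ofReal_rpow_of_nonneg ENNReal.toReal_nonneg hp.le, ENNReal.ofReal_toReal hx]
      _ = ENNReal.ofReal p *
          ∫⁻ t in Set.Ioi 0, ν {x | t < (f x).toReal} * ENNReal.ofReal (t ^ (p - 1)) :=
        lintegral_rpow_eq_lintegral_meas_lt_mul ν (ae_of_all _ fun _ => ENNReal.toReal_nonneg)
          hf.ennreal_toReal hp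
      _ = _ := by
        congr 1
        refine setLIntegral_congr_fun measurableSet_Ioi fun t ht => ?_
        congr 1
        refine measure_congr ?_
        filter_upwards [hfin] with x hx
        exact propext (ENNReal.ofReal_lt_iff_lt_toReal (le_of_lt ht) hx).symm
  · have hpos : ν {x | f x = ∞} ≠ 0 := by simpa [ae_iff] using hfin
    have hlhs : ∫⁻ x, f x ^ p ∂ν = ∞ :=
      lintegral_eq_top_of_measure_eq_top_ne_zero (hf.pow_const p) (by
        simpa [ENNReal.rpow_eq_top_iff, hp, hp.not_gt] using hpos)
    have hrhs : ∫⁻ t in Set.Ioi 0, ν {x | ENNReal.ofReal t < f x} * ENNReal.ofReal (t ^ (p - 1))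
        = ∞ := by
      refine eq_top_mono (lintegral_mono fun t => mul_le_mul_left (measure_mono
        (show {x | f x = ∞} ⊆ {x | ENNReal.ofReal t < f x} from fun x hx => ?_)) _) ?_
      · rw [Set.mem_ofPred_eq] at hx ⊢
        exact hx ▸ ENNReal.ofReal_lt_top
      · rw [lintegral_const_mul _ (by fun_prop), lintegral_Ioi_rpow_eq_top, ENNReal.mul_top hpos]
    rw [hlhs, hrhs, ENNReal.mul_top (by simpa using hp)]

lemma lintegral_const_mul_rpow_withDensity {u : X → ℝ≥0∞} (hu : AEMeasurable u ν) (c : ℝ≥0∞)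
    {q : ℝ} (hq : 1 < q) :
    ∫⁻ x, (c * u x) ^ (q - 1) ∂ν.withDensity u = c ^ (q - 1) * ∫⁻ x, u x ^ q ∂ν := by
  have hq1 : 0 ≤ q - 1 := (sub_pos.2 hq).le
  rw [lintegral_withDensity_eq_lintegral_mul₀ hu ((hu.const_mul c).pow_const _),
    ← lintegral_const_mul'' _ (hu.pow_const q)]
  refine lintegral_congr fun x => ?_
  rw [Pi.mul_apply, ENNReal.mul_rpow_of_nonneg _ _ hq1, mul_left_comm]
  nth_rw 1 [← ENNReal.rpow_one (u x)]
  rw [← ENNReal.rpow_add_of_nonneg _ _ zero_le_one hq1, add_sub_cancel]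

/-- The part of the Marcinkiewicz interpolation theorem between `L¹` and `L^∞` that integrates a
truncated weak type estimate. -/
lemma lintegral_rpow_le_of_weak_type {F u : X → ℝ≥0∞} (hF : AEMeasurable F ν)
    (hu : AEMeasurable u ν) {A B : ℝ≥0∞}
    (h : ∀ t : ℝ, 0 < t → ENNReal.ofReal t * ν {x | ENNReal.ofReal t < F x} ≤
      A * ∫⁻ x in {x | ENNReal.ofReal t < B * u x}, u x ∂ν) {q : ℝ} (hq : 1 < q) :
    ∫⁻ x, F x ^ q ∂ν ≤ A * ENNReal.ofReal (q / (q - 1)) * B ^ (q - 1) * ∫⁻ x, u x ^ q ∂ν := by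
  have hq1 : 0 < q - 1 := sub_pos.2 hq
  have hBu : AEMeasurable (fun x => B * u x) ν := hu.const_mul B
  set φ : ℝ → ℝ≥0∞ := fun t => ν.withDensity u {x | ENNReal.ofReal t < B * u x} *
    ENNReal.ofReal (t ^ (q - 1 - 1))
  have hφ : Measurable φ :=
    Measurable.mul (Antitone.measurable fun s t hst => measure_mono fun x hx =>
      (ENNReal.ofReal_le_ofReal hst).trans_lt hx) (by fun_prop)
  have hFI : ∫⁻ x, F x ^ q ∂ν ≤ ENNReal.ofReal q * (A * ∫⁻ t in Set.Ioi 0, φ t) := by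
    rw [lintegral_rpow_eq_lintegral_measure_lt_mul hF (zero_lt_one.trans hq),
      ← lintegral_const_mul A hφ]
    refine mul_le_mul_right (setLIntegral_mono' measurableSet_Ioi fun t (ht : 0 < t) => ?_) _
    calc ν {x | ENNReal.ofReal t < F x} * ENNReal.ofReal (t ^ (q - 1))
        = ENNReal.ofReal t * ν {x | ENNReal.ofReal t < F x} *
            ENNReal.ofReal (t ^ (q - 1 - 1)) := by
          rw [mul_comm (ENNReal.ofReal t), mul_assoc, ← ENNReal.ofReal_mul ht.le,
            Real.rpow_sub_one ht.ne' (q - 1), mul_div_cancel₀ _ ht.ne']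
      _ ≤ A * (∫⁻ x in {x | ENNReal.ofReal t < B * u x}, u x ∂ν) *
            ENNReal.ofReal (t ^ (q - 1 - 1)) := mul_le_mul_left (h t ht) _
      _ = A * (ν.withDensity u {x | ENNReal.ofReal t < B * u x} *
            ENNReal.ofReal (t ^ (q - 1 - 1))) := by
          rw [withDensity_apply₀ _ (nullMeasurableSet_lt aemeasurable_const hBu), mul_assoc]
  have huI : B ^ (q - 1) * ∫⁻ x, u x ^ q ∂ν = ENNReal.ofReal (q - 1) * ∫⁻ t in Set.Ioi 0, φ t := by
    rw [← lintegral_const_mul_rpow_withDensity hu B hq, lintegral_rpow_eq_lintegral_measure_lt_mul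
      (hBu.mono_ac (withDensity_absolutelyContinuous ν u)) hq1]
  calc ∫⁻ x, F x ^ q ∂ν ≤ ENNReal.ofReal q * (A * ∫⁻ t in Set.Ioi 0, φ t) := hFI
    _ = A * ENNReal.ofReal (q / (q - 1)) * (ENNReal.ofReal (q - 1) * ∫⁻ t in Set.Ioi 0, φ t) := by
      rw [mul_assoc A, ← mul_assoc (ENNReal.ofReal (q / _)), ← ENNReal.ofReal_mul (by positivity),
        div_mul_cancel₀ _ hq1.ne', mul_left_comm]
    _ = _ := by rw [← huI]; ring

end Integration

/-- The pointwise `ℓ^q` norm `lqNorm` for `[0,∞]`-valued functions on an arbitrary type. -/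
def lq {X : Type*} (q : ℝ) (g : ℕ → X → ℝ≥0∞) (x : X) : ℝ≥0∞ := (∑' j, g j x ^ q) ^ (1 / q)

section Minkowski

variable {X : Type*} {q : ℝ} {g : ℕ → X → ℝ≥0∞}

lemma lq_rpow (hq : 0 < q) (g : ℕ → X → ℝ≥0∞) (x : X) : lq q g x ^ q = ∑' j, g j x ^ q := by
  rw [lq, ← ENNReal.rpow_mul, one_div_mul_cancel hq.ne', ENNReal.rpow_one]

lemma le_lq (hq : 0 < q) (g : ℕ → X → ℝ≥0∞) (j : ℕ) (x : X) : g j x ≤ lq q g x := by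
  rw [← ENNReal.rpow_le_rpow_iff hq, lq_rpow hq]
  exact ENNReal.le_tsum j

variable [MeasurableSpace X] {ν : Measure X}

lemma aemeasurable_lq (hg : ∀ j, AEMeasurable (g j) ν) : AEMeasurable (lq q g) ν :=
  (AEMeasurable.tsum fun j => (hg j).pow_const q).pow_const _

/-- Jensen's inequality for the power `q`. -/
lemma lintegral_rpow_le_measure_univ_rpow_mul {f : X → ℝ≥0∞} (hf : AEMeasurable f ν)
    (hq : 1 ≤ q) : (∫⁻ x, f x ∂ν) ^ q ≤ ν Set.univ ^ (q - 1) * ∫⁻ x, f x ^ q ∂ν := by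
  have hq0 : 0 < q := by linarith
  have h := eLpNorm'_le_eLpNorm'_mul_rpow_measure_univ zero_lt_one hq hf.aestronglyMeasurable
  simp only [eLpNorm', enorm_eq_self, ENNReal.rpow_one, div_one] at h
  refine (ENNReal.rpow_le_rpow h hq0.le).trans_eq ?_
  rw [ENNReal.mul_rpow_of_nonneg _ _ hq0.le, ← ENNReal.rpow_mul, ← ENNReal.rpow_mul,
    one_div_mul_cancel hq0.ne', ENNReal.rpow_one, mul_comm, sub_mul, one_mul,
    one_div_mul_cancel hq0.ne']

/-- Minkowski's integral inequality for the `ℓ^q` norm. -/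
lemma tsum_lintegral_rpow_le (hq : 1 ≤ q) (hg : ∀ j, AEMeasurable (g j) ν) :
    ∑' j, (∫⁻ x, g j x ∂ν) ^ q ≤ (∫⁻ x, lq q g x ∂ν) ^ q := by
  have hq0 : 0 < q := by linarith
  set h := lq q g
  have hh : AEMeasurable h ν := aemeasurable_lq hg
  rcases eq_or_ne (∫⁻ x, h x ∂ν) ∞ with htop | htop
  · rw [htop, ENNReal.top_rpow_of_pos hq0]
    exact le_top
  have hdiv : ∀ j, AEMeasurable (fun x => g j x / h x) ν := fun j => (hg j).div hh
  have hdiv' : ∀ j, AEMeasurable (fun x => g j x / h x) (ν.withDensity h) := fun j =>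
    (hdiv j).mono_ac (withDensity_absolutelyContinuous ν h)
  have hg_eq : ∀ j, ∫⁻ x, g j x / h x ∂ν.withDensity h = ∫⁻ x, g j x ∂ν := fun j => by
    rw [lintegral_withDensity_eq_lintegral_mul₀ hh (hdiv j)]
    refine lintegral_congr_ae ?_
    filter_upwards [ae_lt_top' hh htop] with x hx
    exact ENNReal.mul_div_cancel' (fun h0 => le_zero_iff.1 (h0 ▸ le_lq hq0 g j x))
      fun h0 => absurd h0 hx.ne
  have hsum : ∀ x, ∑' j, (g j x / h x) ^ q ≤ 1 := fun x => by
    simp_rw [ENNReal.div_rpow_of_nonneg _ _ hq0.le, div_eq_mul_inv]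
    rw [ENNReal.tsum_mul_right, ← lq_rpow hq0, ← div_eq_mul_inv]
    exact ENNReal.div_self_le_one
  have hmass : ν.withDensity h Set.univ = ∫⁻ x, h x ∂ν := by
    rw [withDensity_apply _ MeasurableSet.univ, setLIntegral_univ]
  calc ∑' j, (∫⁻ x, g j x ∂ν) ^ q
      ≤ ∑' j, (∫⁻ x, h x ∂ν) ^ (q - 1) * ∫⁻ x, (g j x / h x) ^ q ∂ν.withDensity h :=
        ENNReal.tsum_le_tsum fun j => by
          rw [← hg_eq j, ← hmass]
          exact lintegral_rpow_le_measure_univ_rpow_mul (hdiv' j) hq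
    _ = (∫⁻ x, h x ∂ν) ^ (q - 1) * ∫⁻ x, ∑' j, (g j x / h x) ^ q ∂ν.withDensity h := by
        rw [ENNReal.tsum_mul_left, lintegral_tsum fun j => (hdiv' j).pow_const q]
    _ ≤ (∫⁻ x, h x ∂ν) ^ (q - 1) * ∫⁻ x, h x ∂ν := by
        refine mul_le_mul_right ((lintegral_mono hsum).trans_eq ?_) _
        rw [lintegral_one, hmass]
    _ = (∫⁻ x, h x ∂ν) ^ q := by
        nth_rw 2 [← ENNReal.rpow_one (∫⁻ x, h x ∂ν)]
        rw [← ENNReal.rpow_add_of_nonneg _ _ (by linarith) zero_le_one, sub_add_cancel]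

end Minkowski

/-- A sequence of partitions of `X`, each refining the previous one, into measurable sets of
positive finite measure, where passing to a smaller piece divides the measure by at most `D`.
The `k`-th partition consists of the nonempty fibres of `index k`; the labels `ι` do not matter. -/
structure NestedPartition {X : Type*} [MeasurableSpace X] (ι : Type*) (μ : Measure X)
    (D : NNReal) where
  index : ℕ → X → ι
  index_eq_of_succ : ∀ {k x y}, index (k + 1) x = index (k + 1) y → index k x = index k y
  measurableSet_fiber : ∀ k i, MeasurableSet (index k ⁻¹' {i})
  measure_fiber_ne_zero : ∀ k x, μ (index k ⁻¹' {index k x}) ≠ 0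
  measure_fiber_ne_top : ∀ k x, μ (index k ⁻¹' {index k x}) ≠ ∞
  measure_fiber_le : ∀ k x, μ (index k ⁻¹' {index k x}) ≤
    D * μ (index (k + 1) ⁻¹' {index (k + 1) x})

namespace NestedPartition

variable {X ι : Type*} [MeasurableSpace X] {μ : Measure X} {D : NNReal}

/-- The piece of the `k`-th partition that contains `x`. -/
def cell (𝒢 : NestedPartition ι μ D) (k : ℕ) (x : X) : Set X := 𝒢.index k ⁻¹' {𝒢.index k x}

/-- Unions of pieces of the `k`-th partition. -/
def Saturated (𝒢 : NestedPartition ι μ D) (k : ℕ) (S : Set X) : Prop :=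
  ∀ ⦃x y⦄, 𝒢.index k x = 𝒢.index k y → x ∈ S → y ∈ S

/-- The average of `u` over the piece of the `k`-th partition that contains `x`. -/
def avg (𝒢 : NestedPartition ι μ D) (k : ℕ) (u : X → ℝ≥0∞) (x : X) : ℝ≥0∞ :=
  (∫⁻ y in 𝒢.cell k x, u y ∂μ) / μ (𝒢.cell k x)

/-- The nested partition obtained by forgetting the partitions before the `k`-th one. -/
def shift (𝒢 : NestedPartition ι μ D) (k : ℕ) : NestedPartition ι μ D where
  index i := 𝒢.index (k + i)
  index_eq_of_succ h := 𝒢.index_eq_of_succ h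
  measurableSet_fiber i := 𝒢.measurableSet_fiber (k + i)
  measure_fiber_ne_zero i := 𝒢.measure_fiber_ne_zero (k + i)
  measure_fiber_ne_top i := 𝒢.measure_fiber_ne_top (k + i)
  measure_fiber_le i := 𝒢.measure_fiber_le (k + i)

variable {𝒢 : NestedPartition ι μ D} {k l : ℕ} {S T : Set X}

lemma index_eq_of_le (hkl : k ≤ l) {x y : X} (h : 𝒢.index l x = 𝒢.index l y) :
    𝒢.index k x = 𝒢.index k y := by
  induction l, hkl using Nat.le_induction with
  | base => exact h
  | succ l _ ih => exact ih (𝒢.index_eq_of_succ h)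

lemma cell_eq_of_index_eq {x y : X} (h : 𝒢.index k x = 𝒢.index k y) :
    𝒢.cell k x = 𝒢.cell k y := by
  rw [cell, cell, h]

lemma mem_cell_self (k : ℕ) (x : X) : x ∈ 𝒢.cell k x := rfl

lemma cell_subset_cell (hkl : k ≤ l) (x : X) : 𝒢.cell l x ⊆ 𝒢.cell k x :=
  fun _ hy => index_eq_of_le hkl hy

lemma measurableSet_cell (𝒢 : NestedPartition ι μ D) (k : ℕ) (x : X) :
    MeasurableSet (𝒢.cell k x) := 𝒢.measurableSet_fiber k _

lemma measure_cell_ne_zero (𝒢 : NestedPartition ι μ D) (k : ℕ) (x : X) : μ (𝒢.cell k x) ≠ 0 :=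
  𝒢.measure_fiber_ne_zero k x

lemma measure_cell_ne_top (𝒢 : NestedPartition ι μ D) (k : ℕ) (x : X) : μ (𝒢.cell k x) ≠ ∞ :=
  𝒢.measure_fiber_ne_top k x

lemma measure_cell_le (𝒢 : NestedPartition ι μ D) (k : ℕ) (x : X) :
    μ (𝒢.cell k x) ≤ D * μ (𝒢.cell (k + 1) x) := 𝒢.measure_fiber_le k x

lemma one_le_ratio (𝒢 : NestedPartition ι μ D) (x : X) : (1 : ℝ≥0∞) ≤ D := by
  rw [← ENNReal.mul_le_mul_iff_left (𝒢.measure_cell_ne_zero 1 x) (𝒢.measure_cell_ne_top 1 x),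
    one_mul]
  exact (measure_mono (𝒢.cell_subset_cell zero_le_one x)).trans (𝒢.measure_cell_le 0 x)

lemma saturated_cell (𝒢 : NestedPartition ι μ D) (k : ℕ) (x : X) : 𝒢.Saturated k (𝒢.cell k x) :=
  fun _ _ hyz hy => hyz.symm.trans hy

lemma iUnion_inter_fiber (𝒢 : NestedPartition ι μ D) (k : ℕ) (S : Set X) :
    ⋃ i, S ∩ 𝒢.index k ⁻¹' {i} = S := by
  ext x
  simp

namespace Saturated

lemma mono (hS : 𝒢.Saturated k S) (hkl : k ≤ l) : 𝒢.Saturated l S :=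
  fun _ _ h => hS (index_eq_of_le hkl h)

lemma inter (hS : 𝒢.Saturated k S) (hT : 𝒢.Saturated k T) : 𝒢.Saturated k (S ∩ T) :=
  fun _ _ h hx => ⟨hS h hx.1, hT h hx.2⟩

lemma inter_fiber (hS : 𝒢.Saturated k S) (i : ι) :
    S ∩ 𝒢.index k ⁻¹' {i} = ∅ ∨ ∃ x, S ∩ 𝒢.index k ⁻¹' {i} = 𝒢.cell k x := by
  refine (Set.eq_empty_or_nonempty _).imp_right ?_
  rintro ⟨x, hxS, rfl : 𝒢.index k x = i⟩
  exact ⟨x, Set.inter_eq_right.2 fun y hy => hS (Eq.symm hy) hxS⟩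

variable [Countable ι]

lemma measurableSet (hS : 𝒢.Saturated k S) : MeasurableSet S := by
  rw [← 𝒢.iUnion_inter_fiber k S]
  refine MeasurableSet.iUnion fun i => ?_
  obtain h | ⟨x, h⟩ := hS.inter_fiber i
  · rw [h]; exact MeasurableSet.empty
  · rw [h]; exact 𝒢.measurableSet_cell k x

lemma lintegral_eq_tsum (hS : 𝒢.Saturated k S) (u : X → ℝ≥0∞) :
    ∫⁻ x in S, u x ∂μ = ∑' i, ∫⁻ x in S ∩ 𝒢.index k ⁻¹' {i}, u x ∂μ := by
  rw [← lintegral_iUnion (fun i => hS.measurableSet.inter (𝒢.measurableSet_fiber k i)),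
    𝒢.iUnion_inter_fiber]
  exact fun i j h => (pairwise_disjoint_fiber (𝒢.index k) h).mono Set.inter_subset_right
    Set.inter_subset_right

lemma measure_inter_le (hS : 𝒢.Saturated k S) {B : Set X} {c : ℝ≥0∞}
    (h : ∀ x, μ (𝒢.cell k x ∩ B) ≤ c * μ (𝒢.cell k x)) : μ (S ∩ B) ≤ c * μ S := by
  calc μ (S ∩ B) = μ (⋃ i, S ∩ 𝒢.index k ⁻¹' {i} ∩ B) := by
        rw [← Set.iUnion_inter, 𝒢.iUnion_inter_fiber]
    _ ≤ ∑' i, μ (S ∩ 𝒢.index k ⁻¹' {i} ∩ B) := measure_iUnion_le _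
    _ ≤ ∑' i, c * μ (S ∩ 𝒢.index k ⁻¹' {i}) := ENNReal.tsum_le_tsum fun i => by
        obtain h0 | ⟨x, hx⟩ := hS.inter_fiber i
        · simp [h0]
        · simpa only [hx] using h x
    _ = c * μ S := by
        rw [ENNReal.tsum_mul_left, ← setLIntegral_one S, hS.lintegral_eq_tsum]
        simp only [setLIntegral_one]

end Saturated

lemma saturated_disjointed {p : ℕ → Set X} (hp : ∀ i, 𝒢.Saturated i (p i)) (i : ℕ) :
    𝒢.Saturated i (disjointed p i) := by
  intro x y hxy hx
  rw [disjointed_eq_inter_compl] at hx ⊢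
  simp only [Set.mem_inter_iff, Set.mem_iInter, Set.mem_compl_iff] at hx ⊢
  exact ⟨hp i hxy hx.1, fun l hl hy => hx.2 l hl ((hp l).mono hl.le hxy.symm hy)⟩

lemma avg_eq_of_index_eq {x y : X} (h : 𝒢.index k x = 𝒢.index k y) (u : X → ℝ≥0∞) :
    𝒢.avg k u x = 𝒢.avg k u y := by
  rw [avg, avg, cell_eq_of_index_eq h]

lemma avg_mul_measure (𝒢 : NestedPartition ι μ D) (k : ℕ) (u : X → ℝ≥0∞) (x : X) :
    𝒢.avg k u x * μ (𝒢.cell k x) = ∫⁻ y in 𝒢.cell k x, u y ∂μ :=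
  ENNReal.div_mul_cancel (𝒢.measure_cell_ne_zero k x) (𝒢.measure_cell_ne_top k x)

lemma avg_mono {u v : X → ℝ≥0∞} (h : u ≤ v) (k : ℕ) : 𝒢.avg k u ≤ 𝒢.avg k v :=
  fun _ => ENNReal.div_le_div_right (lintegral_mono h) _

lemma avg_const_add (𝒢 : NestedPartition ι μ D) (k : ℕ) (c : ℝ≥0∞) (u : X → ℝ≥0∞) (x : X) :
    𝒢.avg k (fun y => c + u y) x = c + 𝒢.avg k u x := by
  rw [avg, avg, lintegral_add_left measurable_const, setLIntegral_const, ENNReal.add_div,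
    ENNReal.mul_div_cancel_right (𝒢.measure_cell_ne_zero k x) (𝒢.measure_cell_ne_top k x)]

lemma avg_succ_le (𝒢 : NestedPartition ι μ D) (k : ℕ) (u : X → ℝ≥0∞) (x : X) :
    𝒢.avg (k + 1) u x ≤ D * 𝒢.avg k u x := by
  rw [avg, ENNReal.div_le_iff (𝒢.measure_cell_ne_zero _ x) (𝒢.measure_cell_ne_top _ x)]
  calc ∫⁻ y in 𝒢.cell (k + 1) x, u y ∂μ
      ≤ ∫⁻ y in 𝒢.cell k x, u y ∂μ := lintegral_mono_set (cell_subset_cell k.le_succ x)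
    _ = 𝒢.avg k u x * μ (𝒢.cell k x) := (𝒢.avg_mul_measure k u x).symm
    _ ≤ 𝒢.avg k u x * (D * μ (𝒢.cell (k + 1) x)) := mul_le_mul_right (𝒢.measure_cell_le k x) _
    _ = D * 𝒢.avg k u x * μ (𝒢.cell (k + 1) x) := by ring

lemma saturated_lt_avg (𝒢 : NestedPartition ι μ D) (k : ℕ) (u : X → ℝ≥0∞) (c : ℝ≥0∞) :
    𝒢.Saturated k {x | c < 𝒢.avg k u x} :=
  fun _ _ hxy hx => hx.trans_eq (avg_eq_of_index_eq hxy u)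

lemma measurable_avg [Countable ι] (𝒢 : NestedPartition ι μ D) (k : ℕ) (u : X → ℝ≥0∞) :
    Measurable (𝒢.avg k u) :=
  measurable_of_Ioi fun c => (𝒢.saturated_lt_avg k u c).measurableSet

lemma Saturated.lintegral_avg [Countable ι] (hS : 𝒢.Saturated k S) (u : X → ℝ≥0∞) :
    ∫⁻ x in S, 𝒢.avg k u x ∂μ = ∫⁻ x in S, u x ∂μ := by
  rw [hS.lintegral_eq_tsum, hS.lintegral_eq_tsum]
  refine tsum_congr fun i => ?_
  obtain h | ⟨x, h⟩ := hS.inter_fiber i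
  · simp [h]
  · rw [h, ← 𝒢.avg_mul_measure k u x, ← setLIntegral_const]
    exact setLIntegral_congr_fun (𝒢.measurableSet_cell k x) fun y hy => avg_eq_of_index_eq hy u

/-- The maximal function associated with the pieces of all the partitions. -/
def maximalFn (𝒢 : NestedPartition ι μ D) (u : X → ℝ≥0∞) (x : X) : ℝ≥0∞ := ⨆ k, 𝒢.avg k u x

lemma measurable_maximalFn [Countable ι] (𝒢 : NestedPartition ι μ D) (u : X → ℝ≥0∞) :
    Measurable (𝒢.maximalFn u) :=
  Measurable.iSup fun k => 𝒢.measurable_avg k u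

/-- The weak type `(1,1)` inequality: split `{c < 𝒢.maximalFn u}` according to the first `k` for
which `c < 𝒢.avg k u x`. -/
lemma Saturated.mul_measure_lt_maximalFn_le [Countable ι] (hS : 𝒢.Saturated 0 S)
    (u : X → ℝ≥0∞) (c : ℝ≥0∞) :
    c * μ (S ∩ {x | c < 𝒢.maximalFn u x}) ≤ ∫⁻ x in S, u x ∂μ := by
  set p : ℕ → Set X := fun k => S ∩ {x | c < 𝒢.avg k u x}
  have hp : ∀ k, 𝒢.Saturated k (disjointed p k) := saturated_disjointed fun k =>
    (hS.mono k.zero_le).inter (𝒢.saturated_lt_avg k u c)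
  have hU : S ∩ {x | c < 𝒢.maximalFn u x} = ⋃ k, disjointed p k := by
    ext x
    simp [p, iUnion_disjointed, maximalFn, lt_iSup_iff]
  have hm : ∀ k, MeasurableSet (disjointed p k) := fun k => (hp k).measurableSet
  calc c * μ (S ∩ {x | c < 𝒢.maximalFn u x})
      = ∑' k, c * μ (disjointed p k) := by
        rw [hU, measure_iUnion (disjoint_disjointed p) hm, ENNReal.tsum_mul_left]
    _ ≤ ∑' k, ∫⁻ x in disjointed p k, 𝒢.avg k u x ∂μ := by
        refine ENNReal.tsum_le_tsum fun k => ?_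
        rw [← setLIntegral_const]
        exact setLIntegral_mono' (hm k) fun x hx => (disjointed_subset p k hx).2.le
    _ = ∑' k, ∫⁻ x in disjointed p k, u x ∂μ := tsum_congr fun k => (hp k).lintegral_avg u
    _ = ∫⁻ x in ⋃ k, disjointed p k, u x ∂μ :=
        (lintegral_iUnion hm (disjoint_disjointed p) u).symm
    _ ≤ ∫⁻ x in S, u x ∂μ := lintegral_mono_set (hU ▸ Set.inter_subset_left)

/-- The weak type inequality applied to the part of `u` above half the height. -/
lemma Saturated.mul_measure_lt_maximalFn_le_two_mul [Countable ι] (hS : 𝒢.Saturated 0 S)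
    (u : X → ℝ≥0∞) (c : ℝ≥0∞) :
    c * μ (S ∩ {x | c < 𝒢.maximalFn u x}) ≤
      2 * ∫⁻ x in {x | c < 2 * u x}, u x ∂μ.restrict S := by
  set w : X → ℝ≥0∞ := {x | c < 2 * u x}.indicator u
  have hu : u ≤ fun x => c / 2 + w x := fun x => by
    by_cases hx : c < 2 * u x
    · have hwx : w x = u x := Set.indicator_of_mem (s := {x | c < 2 * u x}) hx u
      exact hwx.symm.le.trans le_add_self
    · refine le_add_right ((ENNReal.le_div_iff_mul_le (by simp) (by simp)).2 ?_)
      rw [mul_comm]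
      exact not_lt.1 hx
  have hmax : ∀ x, 𝒢.maximalFn u x ≤ c / 2 + 𝒢.maximalFn w x := fun x =>
    iSup_le fun k => (avg_mono hu k x).trans <| (𝒢.avg_const_add k _ w x).trans_le <|
      add_le_add_right (le_iSup (fun k => 𝒢.avg k w x) k) _
  have hsub : {x | c < 𝒢.maximalFn u x} ⊆ {x | c / 2 < 𝒢.maximalFn w x} := fun x hx => by
    rw [Set.mem_ofPred_eq] at hx ⊢
    by_contra! h
    refine hx.not_ge ((hmax x).trans ((add_le_add_right h _).trans_eq (ENNReal.add_halves c)))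
  calc c * μ (S ∩ {x | c < 𝒢.maximalFn u x})
      ≤ 2 * (c / 2 * μ (S ∩ {x | c / 2 < 𝒢.maximalFn w x})) := by
        rw [← mul_assoc, ENNReal.mul_div_cancel (by simp) (by simp)]
        exact mul_le_mul_right (measure_mono (Set.inter_subset_inter_right S hsub)) c
    _ ≤ 2 * ∫⁻ x in S, w x ∂μ := mul_le_mul_right (hS.mul_measure_lt_maximalFn_le w _) 2
    _ ≤ 2 * ∫⁻ x in {x | c < 2 * u x}, u x ∂μ.restrict S :=
        mul_le_mul_right (lintegral_indicator_le u _) 2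

/-- The `q`-th power of the norm bound on `L^q` for the maximal function. -/
def strongConst (q : ℝ) : ℝ≥0∞ := 2 * ENNReal.ofReal (q / (q - 1)) * 2 ^ (q - 1)

variable {q : ℝ}

lemma strongConst_ne_zero (hq : 1 < q) : strongConst q ≠ 0 := by
  have h : 0 < q / (q - 1) := div_pos (by linarith) (by linarith)
  simp [strongConst, ENNReal.rpow_eq_zero_iff, h]

lemma strongConst_ne_top (hq : 1 < q) : strongConst q ≠ ∞ :=
  ENNReal.mul_ne_top (ENNReal.mul_ne_top ENNReal.ofNat_ne_top ENNReal.ofReal_ne_top)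
    (ENNReal.rpow_ne_top_of_nonneg (sub_nonneg.2 hq.le) ENNReal.ofNat_ne_top)

lemma Saturated.lintegral_maximalFn_rpow_le [Countable ι] (hS : 𝒢.Saturated 0 S)
    {u : X → ℝ≥0∞} (hu : AEMeasurable u μ) (hq : 1 < q) :
    ∫⁻ x in S, 𝒢.maximalFn u x ^ q ∂μ ≤ strongConst q * ∫⁻ x in S, u x ^ q ∂μ := by
  refine lintegral_rpow_le_of_weak_type (𝒢.measurable_maximalFn u).aemeasurable hu.restrict
    (fun t _ => ?_) hq
  rw [Measure.restrict_apply' hS.measurableSet, Set.inter_comm]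
  exact hS.mul_measure_lt_maximalFn_le_two_mul u _

/-- The `q`-th power of the `ℓ^q`-valued maximal function. -/
def vecMaximalFn (𝒢 : NestedPartition ι μ D) (q : ℝ) (g : ℕ → X → ℝ≥0∞) (x : X) : ℝ≥0∞ :=
  ∑' j, 𝒢.maximalFn (g j) x ^ q

lemma Saturated.lintegral_vecMaximalFn_le [Countable ι] (hS : 𝒢.Saturated 0 S)
    {g : ℕ → X → ℝ≥0∞} (hg : ∀ j, AEMeasurable (g j) μ) (hq : 1 < q) :
    ∫⁻ x in S, 𝒢.vecMaximalFn q g x ∂μ ≤ strongConst q * ∫⁻ x in S, ∑' j, g j x ^ q ∂μ := by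
  simp only [vecMaximalFn]
  rw [lintegral_tsum fun j => ((𝒢.measurable_maximalFn (g j)).pow_const q).aemeasurable,
    lintegral_tsum fun j => (hg j).restrict.pow_const q, ← ENNReal.tsum_mul_left]
  exact ENNReal.tsum_le_tsum fun j => hS.lintegral_maximalFn_rpow_le (hg j) hq

/-- The maximal function associated with the partitions before the `N`-th one. -/
def maximalFnBelow (𝒢 : NestedPartition ι μ D) (N : ℕ) (u : X → ℝ≥0∞) (x : X) : ℝ≥0∞ :=
  ⨆ k < N, 𝒢.avg k u x

/-- The analogue of `vecMaximalFn` for the partitions before the `N`-th one. -/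
def vecMaximalFnBelow (𝒢 : NestedPartition ι μ D) (q : ℝ) (N : ℕ) (g : ℕ → X → ℝ≥0∞)
    (x : X) : ℝ≥0∞ :=
  ∑' j, 𝒢.maximalFnBelow N (g j) x ^ q

lemma maximalFn_le_max (𝒢 : NestedPartition ι μ D) (N : ℕ) (u : X → ℝ≥0∞) (x : X) :
    𝒢.maximalFn u x ≤ max (𝒢.maximalFnBelow N u x) ((𝒢.shift N).maximalFn u x) := by
  refine iSup_le fun k => ?_
  rcases lt_or_ge k N with h | h
  · exact le_max_of_le_left (le_iSup₂_of_le k h le_rfl)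
  · obtain ⟨i, rfl⟩ := Nat.exists_eq_add_of_le h
    exact le_max_of_le_right (le_iSup (fun i => (𝒢.shift N).avg i u x) i)

lemma monotone_maximalFnBelow (𝒢 : NestedPartition ι μ D) (u : X → ℝ≥0∞) (x : X) :
    Monotone fun N => 𝒢.maximalFnBelow N u x :=
  fun _ _ h => biSup_mono fun _ hk => lt_of_lt_of_le hk h

lemma iSup_maximalFnBelow (𝒢 : NestedPartition ι μ D) (u : X → ℝ≥0∞) (x : X) :
    ⨆ N, 𝒢.maximalFnBelow N u x = 𝒢.maximalFn u x :=
  biSup_lt_eq_iSup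

lemma maximalFnBelow_eq_of_index_eq {N : ℕ} {x y : X} (h : 𝒢.index N x = 𝒢.index N y)
    (u : X → ℝ≥0∞) : 𝒢.maximalFnBelow (N + 1) u x = 𝒢.maximalFnBelow (N + 1) u y :=
  biSup_congr fun _ hk => avg_eq_of_index_eq (index_eq_of_le (Nat.lt_succ_iff.1 hk) h) u

lemma saturated_lt_vecMaximalFnBelow (𝒢 : NestedPartition ι μ D) (g : ℕ → X → ℝ≥0∞)
    (c : ℝ≥0∞) (N : ℕ) : 𝒢.Saturated N {x | c < 𝒢.vecMaximalFnBelow q (N + 1) g x} :=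
  fun _ _ hxy hx => by
    simpa only [Set.mem_ofPred_eq, vecMaximalFnBelow, maximalFnBelow_eq_of_index_eq hxy] using hx

lemma vecMaximalFnBelow_zero (hq : 0 < q) (𝒢 : NestedPartition ι μ D) (g : ℕ → X → ℝ≥0∞)
    (x : X) : 𝒢.vecMaximalFnBelow q 0 g x = 0 := by
  simp [vecMaximalFnBelow, maximalFnBelow, ENNReal.zero_rpow_of_pos hq]

lemma vecMaximalFn_le_add (hq : 0 ≤ q) (𝒢 : NestedPartition ι μ D) (N : ℕ)
    (g : ℕ → X → ℝ≥0∞) (x : X) :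
    𝒢.vecMaximalFn q g x ≤ 𝒢.vecMaximalFnBelow q N g x + (𝒢.shift N).vecMaximalFn q g x := by
  rw [vecMaximalFn, vecMaximalFnBelow, vecMaximalFn, ← ENNReal.tsum_add]
  refine ENNReal.tsum_le_tsum fun j => ?_
  refine (ENNReal.rpow_le_rpow (𝒢.maximalFn_le_max N (g j) x) hq).trans ?_
  rw [(ENNReal.monotone_rpow_of_nonneg hq).map_max]
  exact max_le_add_of_nonneg zero_le zero_le

lemma monotone_vecMaximalFnBelow (hq : 0 ≤ q) (𝒢 : NestedPartition ι μ D)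
    (g : ℕ → X → ℝ≥0∞) (x : X) : Monotone fun N => 𝒢.vecMaximalFnBelow q N g x :=
  fun _ _ h => ENNReal.tsum_le_tsum fun j =>
    ENNReal.rpow_le_rpow (𝒢.monotone_maximalFnBelow (g j) x h) hq

lemma iSup_vecMaximalFnBelow (hq : 0 < q) (𝒢 : NestedPartition ι μ D) (g : ℕ → X → ℝ≥0∞)
    (x : X) : ⨆ N, 𝒢.vecMaximalFnBelow q N g x = 𝒢.vecMaximalFn q g x := by
  have hmono : ∀ j, Monotone fun N => 𝒢.maximalFnBelow N (g j) x ^ q := fun j _ _ h =>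
    ENNReal.rpow_le_rpow (𝒢.monotone_maximalFnBelow (g j) x h) hq.le
  have hsup : ∀ j, ⨆ N, 𝒢.maximalFnBelow N (g j) x ^ q = 𝒢.maximalFn (g j) x ^ q := fun j => by
    rw [← 𝒢.iSup_maximalFnBelow]
    exact ((ENNReal.orderIsoRpow q hq).map_iSup _).symm
  simp_rw [vecMaximalFnBelow, vecMaximalFn, ← hsup, ENNReal.tsum_eq_iSup_sum]
  rw [iSup_comm]
  exact iSup_congr fun s => (ENNReal.finsetSum_iSup_of_monotone fun j => hmono j).symm

variable {g : ℕ → X → ℝ≥0∞}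

lemma tsum_avg_rpow_le (hq : 1 ≤ q) (hg : ∀ j, AEMeasurable (g j) μ) (k : ℕ) (x : X) :
    ∑' j, 𝒢.avg k (g j) x ^ q ≤ 𝒢.avg k (lq q g) x ^ q := by
  simp_rw [avg, ENNReal.div_rpow_of_nonneg _ _ (zero_le_one.trans hq), div_eq_mul_inv]
  rw [ENNReal.tsum_mul_right]
  exact mul_le_mul_left (tsum_lintegral_rpow_le hq fun j => (hg j).restrict) _

/-- The analogue of a stopping time: whether `τ x = k` depends only on the piece of the `k`-th
partition that contains `x`. -/
def IsStoppingLevel (𝒢 : NestedPartition ι μ D) (τ : X → ℕ) : Prop :=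
  ∀ k, 𝒢.Saturated k {x | τ x = k}

/-- The average of `u` over the piece of the partition number `τ x` that contains `x`. -/
def stoppedAvg (𝒢 : NestedPartition ι μ D) (τ : X → ℕ) (u : X → ℝ≥0∞) (x : X) : ℝ≥0∞ :=
  𝒢.avg (τ x) u x

namespace IsStoppingLevel

variable [Countable ι] {τ : X → ℕ}

lemma measurable_stoppedAvg (hτ : 𝒢.IsStoppingLevel τ) (u : X → ℝ≥0∞) :
    Measurable (𝒢.stoppedAvg τ u) :=
  (measurable_from_prod_countable_right (f := fun p : ℕ × X => 𝒢.avg p.1 u p.2)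
    fun k => 𝒢.measurable_avg k u).comp
    ((measurable_to_countable' fun k => (hτ k).measurableSet).prodMk measurable_id)

lemma lintegral_stoppedAvg (hτ : 𝒢.IsStoppingLevel τ) {k : ℕ} (hS : 𝒢.Saturated k S)
    (hk : ∀ x ∈ S, k ≤ τ x) (u : X → ℝ≥0∞) :
    ∫⁻ x in S, 𝒢.stoppedAvg τ u x ∂μ = ∫⁻ x in S, u x ∂μ := by
  have hsat : ∀ l, 𝒢.Saturated l (S ∩ τ ⁻¹' {l}) := fun l x y hxy hx =>
    (hS.mono ((hk x hx.1).trans_eq hx.2)).inter (hτ l) hxy hx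
  have hd : Pairwise (Function.onFun Disjoint fun l => S ∩ τ ⁻¹' {l}) := fun _ _ hne =>
    (pairwise_disjoint_fiber τ hne).mono Set.inter_subset_right Set.inter_subset_right
  have hU : ⋃ l, S ∩ τ ⁻¹' {l} = S := by
    ext x
    simp
  rw [← hU, lintegral_iUnion (fun l => (hsat l).measurableSet) hd,
    lintegral_iUnion (fun l => (hsat l).measurableSet) hd]
  refine tsum_congr fun l => ?_
  rw [← (hsat l).lintegral_avg u]
  refine setLIntegral_congr_fun (hsat l).measurableSet fun x hx => ?_
  rw [stoppedAvg, show τ x = l from hx.2]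

end IsStoppingLevel

/-- The first `k` for which the average of `h` over the piece of `x` exceeds `c`, capped at `N`. -/
def stoppingLevel (𝒢 : NestedPartition ι μ D) (h : X → ℝ≥0∞) (c : ℝ≥0∞) (N : ℕ) (x : X) : ℕ :=
  sInf {k | k = N ∨ c < 𝒢.avg k h x}

section StoppingLevel

variable {h : X → ℝ≥0∞} {c : ℝ≥0∞} {N : ℕ} {x : X}

lemma stoppingLevel_spec :
    𝒢.stoppingLevel h c N x = N ∨ c < 𝒢.avg (𝒢.stoppingLevel h c N x) h x :=
  Nat.sInf_mem (s := {k | k = N ∨ c < 𝒢.avg k h x}) ⟨N, Or.inl rfl⟩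

lemma stoppingLevel_le_of_index_eq {y : X}
    (hxy : 𝒢.index (𝒢.stoppingLevel h c N x) x = 𝒢.index (𝒢.stoppingLevel h c N x) y) :
    𝒢.stoppingLevel h c N y ≤ 𝒢.stoppingLevel h c N x :=
  Nat.sInf_le (stoppingLevel_spec.imp_right fun hx => hx.trans_eq (avg_eq_of_index_eq hxy h))

lemma isStoppingLevel_stoppingLevel (𝒢 : NestedPartition ι μ D) (h : X → ℝ≥0∞) (c : ℝ≥0∞)
    (N : ℕ) : 𝒢.IsStoppingLevel (𝒢.stoppingLevel h c N) := by
  rintro _ x y hxy rfl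
  have hyx := stoppingLevel_le_of_index_eq hxy
  exact hyx.antisymm (stoppingLevel_le_of_index_eq (index_eq_of_le hyx hxy.symm))

lemma avg_stoppingLevel_le (𝒢 : NestedPartition ι μ D) (h : X → ℝ≥0∞) (c : ℝ≥0∞) (N : ℕ)
    (x : X) : 𝒢.avg (𝒢.stoppingLevel h c N x) h x ≤ max (𝒢.avg 0 h x) (D * c) := by
  rcases hk : 𝒢.stoppingLevel h c N x with _ | k
  · exact le_max_left _ _
  · have hkc : k ∉ {k | k = N ∨ c < 𝒢.avg k h x} :=
      Nat.notMem_of_lt_sInf (k.lt_succ_self.trans_eq hk.symm)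
    simp only [Set.mem_ofPred_eq, not_or, not_lt] at hkc
    exact le_max_of_le_right ((𝒢.avg_succ_le k h x).trans (mul_le_mul_right hkc.2 _))

lemma le_stoppingLevel (hx : 𝒢.maximalFn h x ≤ c) {k : ℕ} (hk : k ≤ N) {y : X}
    (hy : y ∈ 𝒢.cell k x) : k ≤ 𝒢.stoppingLevel h c N y := by
  by_contra! hlt
  obtain hN | hc := stoppingLevel_spec (𝒢 := 𝒢) (h := h) (c := c) (N := N) (x := y)
  · omega
  · rw [avg_eq_of_index_eq (index_eq_of_le hlt.le hy)] at hc
    exact hc.not_ge ((le_iSup (fun l => 𝒢.avg l h x) _).trans hx)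

lemma avg_stoppedAvg [Countable ι] (hx : 𝒢.maximalFn h x ≤ c) {k : ℕ} (hk : k ≤ N)
    (u : X → ℝ≥0∞) : 𝒢.avg k (𝒢.stoppedAvg (𝒢.stoppingLevel h c N) u) x = 𝒢.avg k u x := by
  rw [avg, avg, (𝒢.isStoppingLevel_stoppingLevel h c N).lintegral_stoppedAvg
    (𝒢.saturated_cell k x) fun y hy => le_stoppingLevel hx hk hy]

lemma vecMaximalFnBelow_le_of_maximalFn_le [Countable ι] (hq : 0 ≤ q)
    (hx : 𝒢.maximalFn h x ≤ c) (g : ℕ → X → ℝ≥0∞) :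
    𝒢.vecMaximalFnBelow q N g x ≤
      𝒢.vecMaximalFn q (fun j => 𝒢.stoppedAvg (𝒢.stoppingLevel h c N) (g j)) x := by
  refine ENNReal.tsum_le_tsum fun j => ENNReal.rpow_le_rpow (iSup₂_le fun k hk => ?_) hq
  rw [← avg_stoppedAvg hx hk.le]
  exact le_iSup (fun k => 𝒢.avg k _ x) k

lemma tsum_stoppedAvg_rpow_le (hq : 1 ≤ q) (hg : ∀ j, AEMeasurable (g j) μ) (c : ℝ≥0∞) (N : ℕ)
    (x : X) : ∑' j, 𝒢.stoppedAvg (𝒢.stoppingLevel (lq q g) c N) (g j) x ^ q ≤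
      max (𝒢.avg 0 (lq q g) x) (D * c) ^ q :=
  (tsum_avg_rpow_le hq hg _ x).trans
    (ENNReal.rpow_le_rpow (𝒢.avg_stoppingLevel_le _ c N x) (zero_le_one.trans hq))

end StoppingLevel

/-- The constant `Λ` such that `𝒢.vecMaximalFn q g` exceeds `Λ` times the `q`-th power of the
average of `lq q g` over a piece at most on half of that piece. -/
def decayConst (q : ℝ) (D : NNReal) : ℝ≥0∞ := 4 * strongConst q * (4 * D) ^ q

lemma decayConst_ne_zero (hq : 1 < q) (hD : D ≠ 0) : decayConst q D ≠ 0 := by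
  have hq0 : ¬ q < 0 := by linarith
  simp [decayConst, strongConst_ne_zero hq, ENNReal.rpow_eq_zero_iff, hD, hq0]

lemma decayConst_ne_top (hq : 1 < q) : decayConst q D ≠ ∞ :=
  ENNReal.mul_ne_top (ENNReal.mul_ne_top ENNReal.ofNat_ne_top (strongConst_ne_top hq))
    (ENNReal.rpow_ne_top_of_nonneg (by linarith)
      (ENNReal.mul_ne_top ENNReal.ofNat_ne_top ENNReal.coe_ne_top))

lemma le_inv_mul_of_mul_mul_le {a b m M : ℝ≥0∞} (ha0 : a ≠ 0) (ha : a ≠ ∞) (hb0 : b ≠ 0)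
    (hb : b ≠ ∞) (h : a * b * m ≤ b * M) : m ≤ a⁻¹ * M := by
  rw [mul_right_comm, mul_comm b, ENNReal.mul_le_mul_iff_left hb0 hb] at h
  rwa [mul_comm, ← div_eq_mul_inv, ENNReal.le_div_iff_mul_le (Or.inl ha0) (Or.inl ha), mul_comm]

lemma vecMaximalFn_eq_zero (hq : 0 < q) {x : X} (hx : 𝒢.avg 0 (lq q g) x = 0) :
    𝒢.vecMaximalFn q g x = 0 := by
  have havg : ∀ k, 𝒢.avg k (lq q g) x = 0 := fun k => by
    induction k with
    | zero => exact hx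
    | succ k ih => simpa [ih] using 𝒢.avg_succ_le k (lq q g) x
  have hmax : ∀ j, 𝒢.maximalFn (g j) x = 0 := fun j => by
    refine le_zero_iff.1 (iSup_le fun k => ?_)
    rw [← havg k]
    exact avg_mono (le_lq hq g j) k x
  simp [vecMaximalFn, hmax, hq]

section GoodLambda

variable [Countable ι] {x₀ : X}

lemma measure_lt_maximalFn_le {h : X → ℝ≥0∞} (h0 : 𝒢.avg 0 h x₀ ≠ 0) (h1 : 𝒢.avg 0 h x₀ ≠ ∞) :
    μ (𝒢.cell 0 x₀ ∩ {x | 4 * 𝒢.avg 0 h x₀ < 𝒢.maximalFn h x}) ≤ 4⁻¹ * μ (𝒢.cell 0 x₀) := by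
  refine le_inv_mul_of_mul_mul_le (by simp) (by simp) h0 h1 ?_
  rw [𝒢.avg_mul_measure]
  exact (𝒢.saturated_cell 0 x₀).mul_measure_lt_maximalFn_le h _

lemma measure_le_vecMaximalFn_le (hq : 1 < q) {v : ℕ → X → ℝ≥0∞}
    (hv : ∀ j, AEMeasurable (v j) μ) {b : ℝ≥0∞} (hb0 : b ≠ 0) (hb : b ≠ ∞)
    (hvb : ∀ x ∈ 𝒢.cell 0 x₀, ∑' j, v j x ^ q ≤ b) :
    μ (𝒢.cell 0 x₀ ∩ {x | 4 * (strongConst q * b) ≤ 𝒢.vecMaximalFn q v x}) ≤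
      4⁻¹ * μ (𝒢.cell 0 x₀) := by
  have hP : 𝒢.Saturated 0 (𝒢.cell 0 x₀) := 𝒢.saturated_cell 0 x₀
  refine le_inv_mul_of_mul_mul_le (by simp) (by simp) (mul_ne_zero (strongConst_ne_zero hq) hb0)
    (ENNReal.mul_ne_top (strongConst_ne_top hq) hb) ?_
  calc 4 * (strongConst q * b) *
        μ (𝒢.cell 0 x₀ ∩ {x | 4 * (strongConst q * b) ≤ 𝒢.vecMaximalFn q v x})
      ≤ ∫⁻ x in 𝒢.cell 0 x₀, 𝒢.vecMaximalFn q v x ∂μ := by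
        rw [Set.inter_comm, ← Measure.restrict_apply' (𝒢.measurableSet_cell 0 x₀)]
        exact mul_meas_ge_le_lintegral (Measurable.tsum fun j =>
          (𝒢.measurable_maximalFn (v j)).pow_const q) _
    _ ≤ strongConst q * ∫⁻ x in 𝒢.cell 0 x₀, ∑' j, v j x ^ q ∂μ :=
        hP.lintegral_vecMaximalFn_le hv hq
    _ ≤ strongConst q * ∫⁻ _ in 𝒢.cell 0 x₀, b ∂μ :=
        mul_le_mul_right (setLIntegral_mono' hP.measurableSet hvb) _
    _ = strongConst q * b * μ (𝒢.cell 0 x₀) := by rw [setLIntegral_const, mul_assoc]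

lemma measure_lt_vecMaximalFnBelow_le_half (hq : 1 < q) (hg : ∀ j, AEMeasurable (g j) μ) (N : ℕ)
    (h0 : 𝒢.avg 0 (lq q g) x₀ ≠ 0) (h1 : 𝒢.avg 0 (lq q g) x₀ ≠ ∞) :
    μ (𝒢.cell 0 x₀ ∩
        {x | decayConst q D * 𝒢.avg 0 (lq q g) x₀ ^ q < 𝒢.vecMaximalFnBelow q N g x}) ≤
      2⁻¹ * μ (𝒢.cell 0 x₀) := by
  have hq0 : 0 < q := by linarith
  set P := 𝒢.cell 0 x₀
  set a := 𝒢.avg 0 (lq q g) x₀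
  set τ := 𝒢.stoppingLevel (lq q g) (4 * a) N
  set v : ℕ → X → ℝ≥0∞ := fun j => 𝒢.stoppedAvg τ (g j)
  set b := (4 * D * a) ^ q
  have hD : (1 : ℝ≥0∞) ≤ D := 𝒢.one_le_ratio x₀
  have hvb : ∀ x ∈ P, ∑' j, v j x ^ q ≤ b := fun x hx => by
    refine (tsum_stoppedAvg_rpow_le hq.le hg (4 * a) N x).trans (ENNReal.rpow_le_rpow ?_ hq0.le)
    rw [avg_eq_of_index_eq hx, mul_left_comm, ← mul_assoc]
    exact max_le (le_mul_of_one_le_left' (one_le_mul (by norm_num) hD)) le_rfl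
  have hb0 : b ≠ 0 := by
    have hD0 : D ≠ 0 := by rintro rfl; simp at hD
    simp [b, ENNReal.rpow_eq_zero_iff, h0, hD0, hq0.not_gt]
  have hb : b ≠ ∞ := ENNReal.rpow_ne_top_of_nonneg hq0.le
    (ENNReal.mul_ne_top (ENNReal.mul_ne_top ENNReal.ofNat_ne_top ENNReal.coe_ne_top) h1)
  have hθ : decayConst q D * a ^ q = 4 * (strongConst q * b) := by
    rw [decayConst, show b = (4 * D) ^ q * a ^ q from ENNReal.mul_rpow_of_nonneg _ a hq0.le]
    ring
  have hsub : P ∩ {x | decayConst q D * a ^ q < 𝒢.vecMaximalFnBelow q N g x} ⊆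
      (P ∩ {x | 4 * a < 𝒢.maximalFn (lq q g) x}) ∪
        (P ∩ {x | 4 * (strongConst q * b) ≤ 𝒢.vecMaximalFn q v x}) := by
    rintro x ⟨hxP, hx⟩
    rw [Set.mem_ofPred_eq] at hx
    refine (lt_or_ge (4 * a) (𝒢.maximalFn (lq q g) x)).imp (fun h => ⟨hxP, h⟩) fun h => ⟨hxP, ?_⟩
    exact hθ.symm.trans_le (hx.le.trans (vecMaximalFnBelow_le_of_maximalFn_le hq0.le h g))
  calc μ (P ∩ {x | decayConst q D * a ^ q < 𝒢.vecMaximalFnBelow q N g x})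
      ≤ 4⁻¹ * μ P + 4⁻¹ * μ P := (measure_mono hsub).trans <| (measure_union_le _ _).trans <|
        add_le_add (measure_lt_maximalFn_le h0 h1) <| measure_le_vecMaximalFn_le hq (fun j =>
          ((𝒢.isStoppingLevel_stoppingLevel _ _ _).measurable_stoppedAvg _).aemeasurable)
          hb0 hb hvb
    _ = 2⁻¹ * μ P := by
        rw [← two_mul, ← mul_assoc, show (4 : ℝ≥0∞) = 2 * 2 by norm_num,
          ENNReal.mul_inv (by simp) (by simp), ← mul_assoc,
          ENNReal.mul_inv_cancel (by simp) (by simp), one_mul]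

lemma measure_lt_vecMaximalFn_le_half (hq : 1 < q) (hg : ∀ j, AEMeasurable (g j) μ) :
    μ (𝒢.cell 0 x₀ ∩
        {x | decayConst q D * 𝒢.avg 0 (lq q g) x₀ ^ q < 𝒢.vecMaximalFn q g x}) ≤
      2⁻¹ * μ (𝒢.cell 0 x₀) := by
  have hq0 : 0 < q := by linarith
  rcases eq_or_ne (𝒢.avg 0 (lq q g) x₀) 0 with h0 | h0
  · have hempty : 𝒢.cell 0 x₀ ∩
        {x | decayConst q D * 𝒢.avg 0 (lq q g) x₀ ^ q < 𝒢.vecMaximalFn q g x} = ∅ := by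
      refine Set.eq_empty_of_forall_notMem fun x ⟨hxP, hx⟩ => ?_
      rw [Set.mem_ofPred_eq, vecMaximalFn_eq_zero hq0 ((avg_eq_of_index_eq hxP _).trans h0)] at hx
      exact not_lt_zero hx
    simp [hempty]
  rcases eq_or_ne (𝒢.avg 0 (lq q g) x₀) ∞ with h1 | h1
  · have hD : D ≠ 0 := by
      rintro rfl
      simpa using 𝒢.one_le_ratio x₀
    simp [h1, hq0, ENNReal.mul_top (decayConst_ne_zero hq hD)]
  have hmono : Monotone fun N => 𝒢.cell 0 x₀ ∩
      {x | decayConst q D * 𝒢.avg 0 (lq q g) x₀ ^ q < 𝒢.vecMaximalFnBelow q N g x} :=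
    fun _ _ h x hx => ⟨hx.1, hx.2.trans_le (𝒢.monotone_vecMaximalFnBelow hq0.le g x h)⟩
  simp only [← 𝒢.iSup_vecMaximalFnBelow hq0, lt_iSup_iff, Set.ofPred_exists, Set.inter_iUnion]
  rw [hmono.measure_iUnion]
  exact iSup_le fun N => measure_lt_vecMaximalFnBelow_le_half hq hg N h0 h1

end GoodLambda

variable {θ : ℝ≥0∞}

lemma vecMaximalFnBelow_le_of_mem_disjointed (hq : 0 < q) {i : ℕ} {x : X}
    (hx : x ∈ disjointed (fun i => {y | θ < 𝒢.vecMaximalFnBelow q (i + 1) g y}) i) :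
    𝒢.vecMaximalFnBelow q i g x ≤ θ := by
  cases i with
  | zero => simp [vecMaximalFnBelow_zero hq]
  | succ i =>
    rw [disjointed_eq_inter_compl] at hx
    exact not_lt.1 (Set.mem_iInter₂.1 hx.2 i i.lt_succ_self)

lemma iUnion_lt_vecMaximalFnBelow_succ (hq : 0 < q) (𝒢 : NestedPartition ι μ D)
    (g : ℕ → X → ℝ≥0∞) (θ : ℝ≥0∞) :
    ⋃ i, {y | θ < 𝒢.vecMaximalFnBelow q (i + 1) g y} = {y | θ < 𝒢.vecMaximalFn q g y} := by
  ext y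
  rw [Set.mem_iUnion, Set.mem_ofPred_eq, ← 𝒢.iSup_vecMaximalFnBelow hq,
    ← (𝒢.monotone_vecMaximalFnBelow hq.le g y).iSup_nat_add 1, lt_iSup_iff]
  rfl

/-- Split `{θ < 𝒢.vecMaximalFn q g}` according to the first level at which `θ` is exceeded: up to
there the coarser levels contribute at most `θ`, so the finer ones must exceed `F`. -/
lemma Saturated.measure_add_lt_vecMaximalFn_le [Countable ι] (hS : 𝒢.Saturated 0 S) (hq : 0 < q)
    {F : X → ℝ≥0∞} {c : ℝ≥0∞} (hF : ∀ i x,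
      μ (𝒢.cell i x ∩ {y | F y < (𝒢.shift i).vecMaximalFn q g y}) ≤ c * μ (𝒢.cell i x)) :
    μ (S ∩ {y | θ + F y < 𝒢.vecMaximalFn q g y}) ≤
      c * μ (S ∩ {y | θ < 𝒢.vecMaximalFn q g y}) := by
  set p : ℕ → Set X := fun i => {y | θ < 𝒢.vecMaximalFnBelow q (i + 1) g y}
  have hT : ∀ i, 𝒢.Saturated i (S ∩ disjointed p i) := fun i => (hS.mono i.zero_le).inter <|
    saturated_disjointed (𝒢.saturated_lt_vecMaximalFnBelow g θ) i
  have hd : Pairwise (Function.onFun Disjoint fun i => S ∩ disjointed p i) := fun _ _ hne =>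
    (disjoint_disjointed p hne).mono Set.inter_subset_right Set.inter_subset_right
  have hU : ⋃ i, S ∩ disjointed p i = S ∩ {y | θ < 𝒢.vecMaximalFn q g y} := by
    rw [← Set.inter_iUnion, iUnion_disjointed, iUnion_lt_vecMaximalFnBelow_succ hq]
  have hsub : S ∩ {y | θ + F y < 𝒢.vecMaximalFn q g y} ⊆
      ⋃ i, S ∩ disjointed p i ∩ {y | F y < (𝒢.shift i).vecMaximalFn q g y} := by
    rintro y ⟨hyS, hy⟩
    rw [Set.mem_ofPred_eq] at hy
    obtain ⟨i, hi⟩ := Set.mem_iUnion.1 (hU.ge ⟨hyS, le_self_add.trans_lt hy⟩)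
    refine Set.mem_iUnion.2 ⟨i, hi, lt_of_add_lt_add_left (hy.trans_le ?_)⟩
    exact (𝒢.vecMaximalFn_le_add hq.le i g y).trans
      (add_le_add_left (vecMaximalFnBelow_le_of_mem_disjointed hq hi.2) _)
  calc μ (S ∩ {y | θ + F y < 𝒢.vecMaximalFn q g y})
      ≤ ∑' i, μ (S ∩ disjointed p i ∩ {y | F y < (𝒢.shift i).vecMaximalFn q g y}) :=
        (measure_mono hsub).trans (measure_iUnion_le _)
    _ ≤ ∑' i, c * μ (S ∩ disjointed p i) :=
        ENNReal.tsum_le_tsum fun i => (hT i).measure_inter_le (hF i)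
    _ = c * μ (S ∩ {y | θ < 𝒢.vecMaximalFn q g y}) := by
        rw [ENNReal.tsum_mul_left, ← hU, measure_iUnion hd fun i => (hT i).measurableSet]

lemma measure_lt_vecMaximalFn_le [Countable ι] (hq : 1 < q) (hg : ∀ j, AEMeasurable (g j) μ)
    {H : X → ℝ≥0∞} (hH : ∀ i x, 𝒢.avg i (lq q g) x ≤ H x) (m : ℕ) (x₀ : X) :
    μ (𝒢.cell 0 x₀ ∩ {x | m * decayConst q D * H x ^ q < 𝒢.vecMaximalFn q g x}) ≤
      2⁻¹ ^ m * μ (𝒢.cell 0 x₀) := by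
  have hq0 : 0 < q := by linarith
  induction m generalizing 𝒢 x₀ with
  | zero => simpa using measure_mono Set.inter_subset_left
  | succ m ih =>
    set θ := decayConst q D * 𝒢.avg 0 (lq q g) x₀ ^ q
    have hθ : ∀ x ∈ 𝒢.cell 0 x₀, θ ≤ decayConst q D * H x ^ q := fun x hx =>
      mul_le_mul_right (ENNReal.rpow_le_rpow ((avg_eq_of_index_eq hx _).ge.trans (hH 0 x)) hq0.le) _
    have hsub : 𝒢.cell 0 x₀ ∩
          {x | (m + 1 : ℕ) * decayConst q D * H x ^ q < 𝒢.vecMaximalFn q g x} ⊆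
        𝒢.cell 0 x₀ ∩ {x | θ + m * decayConst q D * H x ^ q < 𝒢.vecMaximalFn q g x} := by
      rintro x ⟨hxP, hx⟩
      rw [Set.mem_ofPred_eq, Nat.cast_succ, add_one_mul, add_mul, add_comm] at hx
      exact ⟨hxP, (add_le_add_left (hθ x hxP) _).trans_lt hx⟩
    calc μ (𝒢.cell 0 x₀ ∩ {x | (m + 1 : ℕ) * decayConst q D * H x ^ q < 𝒢.vecMaximalFn q g x})
        ≤ 2⁻¹ ^ m * μ (𝒢.cell 0 x₀ ∩ {x | θ < 𝒢.vecMaximalFn q g x}) :=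
          (measure_mono hsub).trans <| (𝒢.saturated_cell 0 x₀).measure_add_lt_vecMaximalFn_le hq0
            fun i => ih (𝒢 := 𝒢.shift i) fun l => hH (i + l)
      _ ≤ 2⁻¹ ^ m * (2⁻¹ * μ (𝒢.cell 0 x₀)) :=
          mul_le_mul_right (measure_lt_vecMaximalFn_le_half hq hg) _
      _ = 2⁻¹ ^ (m + 1) * μ (𝒢.cell 0 x₀) := by rw [pow_succ, mul_assoc]

end NestedPartition

variable {n : ℕ} {a b c x : Fin n → ℝ} {L l r : ℝ}

lemma volume_Icc_add (c : Fin n → ℝ) (r : ℝ) :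
    volume (Set.Icc c fun i => c i + r) = ENNReal.ofReal r ^ n := by
  simp [Real.volume_Icc_pi]

/-- The label of the dyadic cube containing `x`, in the decomposition of `ℝⁿ` into half-open cubes
of side `L / 2 ^ k` one of which has corner `a`. -/
def gridIndex (a : Fin n → ℝ) (L : ℝ) (k : ℕ) (x : Fin n → ℝ) (i : Fin n) : ℤ :=
  ⌊(x i - a i) / (L / 2 ^ k)⌋

lemma gridIndex_eq_gridIndex_succ_div_two (k : ℕ) (i : Fin n) :
    gridIndex a L k x i = gridIndex a L (k + 1) x i / 2 := by
  rw [gridIndex, gridIndex, ← Nat.cast_ofNat (R := ℤ), ← Int.floor_div_natCast, pow_succ]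
  congr 1
  push_cast
  field_simp

lemma gridIndex_preimage_singleton (a : Fin n → ℝ) (hL : 0 < L) (k : ℕ) (m : Fin n → ℤ) :
    gridIndex a L k ⁻¹' {m} = Set.univ.pi fun i =>
      Set.Ico (a i + m i * (L / 2 ^ k)) (a i + m i * (L / 2 ^ k) + L / 2 ^ k) := by
  have hδ : 0 < L / 2 ^ k := by positivity
  ext y
  simp only [Set.mem_preimage, Set.mem_singleton_iff, funext_iff, Set.mem_univ_pi, Set.mem_Ico,
    gridIndex, Int.floor_eq_iff, le_div_iff₀ hδ, div_lt_iff₀ hδ, add_one_mul]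
  refine forall_congr' fun i => and_congr ?_ ?_ <;> constructor <;> intro h <;> linarith

lemma volume_gridIndex_preimage_singleton (a : Fin n → ℝ) (hL : 0 < L) (k : ℕ) (m : Fin n → ℤ) :
    volume (gridIndex a L k ⁻¹' {m}) = ENNReal.ofReal (L / 2 ^ k) ^ n := by
  rw [gridIndex_preimage_singleton a hL, Real.volume_pi_Ico]
  simp

/-- The dyadic grid of `ℝⁿ` with origin `a` and largest side length `L`. -/
def grid (a : Fin n → ℝ) (hL : 0 < L) :
    NestedPartition (Fin n → ℤ) (volume : Measure (Fin n → ℝ)) (2 ^ n) where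
  index := gridIndex a L
  index_eq_of_succ {k x y} h := by
    ext i
    rw [gridIndex_eq_gridIndex_succ_div_two, h, ← gridIndex_eq_gridIndex_succ_div_two]
  measurableSet_fiber k m := by
    rw [gridIndex_preimage_singleton a hL]
    exact MeasurableSet.univ_pi fun i => measurableSet_Ico
  measure_fiber_ne_zero k x := by
    rw [volume_gridIndex_preimage_singleton a hL]
    exact pow_ne_zero _ (ENNReal.ofReal_pos.2 (by positivity)).ne'
  measure_fiber_ne_top k x := by
    rw [volume_gridIndex_preimage_singleton a hL]
    exact ENNReal.pow_ne_top ENNReal.ofReal_ne_top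
  measure_fiber_le k x := by
    rw [volume_gridIndex_preimage_singleton a hL, volume_gridIndex_preimage_singleton a hL,
      ENNReal.coe_pow, ← mul_pow, ENNReal.coe_ofNat, ← ENNReal.ofReal_ofNat 2,
      ← ENNReal.ofReal_mul zero_le_two, pow_succ, ← div_div, mul_div_cancel₀ _ two_ne_zero]

lemma volume_grid_cell (a : Fin n → ℝ) (hL : 0 < L) (k : ℕ) (x : Fin n → ℝ) :
    volume ((grid a hL).cell k x) = ENNReal.ofReal (L / 2 ^ k) ^ n :=
  volume_gridIndex_preimage_singleton a hL k _

lemma avg_grid_le_maximal {ε : Type*} [ENorm ε] (f : (Fin n → ℝ) → ε) (a : Fin n → ℝ)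
    (hL : 0 < L) (k : ℕ) (x : Fin n → ℝ) :
    (grid a hL).avg k (fun y => ‖f y‖ₑ) x ≤ maximal f x := by
  set Q := Set.Icc (fun i => a i + gridIndex a L k x i * (L / 2 ^ k)) fun i =>
    a i + gridIndex a L k x i * (L / 2 ^ k) + L / 2 ^ k with hQ
  have hsub : (grid a hL).cell k x ⊆ Q := by
    rw [show (grid a hL).cell k x = _ from gridIndex_preimage_singleton a hL k _, hQ,
      ← Set.pi_univ_Icc]
    exact Set.pi_mono fun i _ => Set.Ico_subset_Icc_self
  have hcube : IsCube Q := ⟨_, L / 2 ^ k, by positivity, rfl⟩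
  refine le_iSup_of_le Q (le_iSup₂_of_le hcube (hsub (NestedPartition.mem_cell_self k x)) ?_)
  rw [NestedPartition.avg, volume_grid_cell, hQ, volume_Icc_add]
  exact ENNReal.div_le_div_right (lintegral_mono_set hsub) _

lemma Icc_subset_grid_cell {k : ℕ} (hL : 0 < L)
    (h : ∀ i, ⌊(c i - a i) / (L / 2 ^ k) + r / (L / 2 ^ k)⌋ = ⌊(c i - a i) / (L / 2 ^ k)⌋)
    (hx : x ∈ Set.Icc c fun i => c i + r) :
    Set.Icc c (fun i => c i + r) ⊆ (grid a hL).cell k x := by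
  have hδ : 0 < L / 2 ^ k := by positivity
  have hidx : ∀ y ∈ Set.Icc c fun i => c i + r, gridIndex a L k y = gridIndex a L k c := by
    refine fun y hy => funext fun i => le_antisymm ?_ ?_
    · rw [gridIndex, gridIndex, ← h i, ← add_div]
      have hyr : y i ≤ c i + r := hy.2 i
      exact Int.floor_mono (div_le_div_of_nonneg_right (by linarith) hδ.le)
    · exact Int.floor_mono (div_le_div_of_nonneg_right (sub_le_sub_right (hy.1 i) _) hδ.le)
  exact fun y hy => (hidx y hy).trans (hidx x hx).symm

/-- If both pairs of floors differed, an integer and an integer plus `2 ^ k / 3` would be less than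
`1 / 3` apart, whereas `3` does not divide `2 ^ k`. -/
lemma floor_add_eq_or_floor_sub_add_eq (k : ℕ) (z : ℝ) {ρ : ℝ} (hρ : 0 ≤ ρ) (hρ3 : ρ ≤ 1 / 3) :
    ⌊z + ρ⌋ = ⌊z⌋ ∨ ⌊z - 2 ^ k / 3 + ρ⌋ = ⌊z - 2 ^ k / 3⌋ := by
  have exists_int : ∀ w : ℝ, ⌊w + ρ⌋ ≠ ⌊w⌋ → ∃ m : ℤ, w < m ∧ m ≤ w + ρ := fun w hw =>
    ⟨⌊w + ρ⌋, Int.floor_lt.1 ((Int.floor_mono (le_add_of_nonneg_right hρ)).lt_of_ne' hw),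
      Int.floor_le _⟩
  by_contra! h
  obtain ⟨m, hm, hm'⟩ := exists_int _ h.1
  obtain ⟨m', hl, hl'⟩ := exists_int _ h.2
  have hlt : ((3 * (m - m') - 2 ^ k : ℤ) : ℝ) < 1 := by push_cast; linarith
  have hgt : (-1 : ℝ) < (3 * (m - m') - 2 ^ k : ℤ) := by push_cast; linarith
  have hzero : 3 * (m - m') - 2 ^ k = 0 := by
    have : 3 * (m - m') - 2 ^ k < 1 := by exact_mod_cast hlt
    have : -1 < 3 * (m - m') - 2 ^ k := by exact_mod_cast hgt
    omega
  have hdvd : (3 : ℤ) ∣ 2 ^ k := ⟨m - m', (sub_eq_zero.1 hzero).symm⟩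
  exact absurd (Int.prime_three.dvd_of_dvd_pow hdvd) (by norm_num)

/-- The `2 ^ n` dyadic grids attached to the cube with corner `b` and side `l`: they have largest
side `3 * l`, a coarsest piece containing the cube, and differ by a translation by `l` in the
coordinates selected by `s`. -/
def adjacentGrid (b : Fin n → ℝ) (hl : 0 < l) (s : Fin n → Bool) :
    NestedPartition (Fin n → ℤ) (volume : Measure (Fin n → ℝ)) (2 ^ n) :=
  grid (L := 3 * l) (fun i => b i - 3 * l / 2 + if s i then l else 0) (by positivity)

lemma Icc_subset_adjacentGrid_cell_zero (hl : 0 < l) (s : Fin n → Bool)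
    (hx : x ∈ Set.Icc b fun i => b i + l) :
    Set.Icc b (fun i => b i + l) ⊆ (adjacentGrid b hl s).cell 0 x := by
  refine Icc_subset_grid_cell _ (fun i => ?_) hx
  have hpos : ⌊(b i - (b i - 3 * l / 2 + if s i then l else 0)) / (3 * l / 2 ^ 0)⌋ = 0 := by
    rw [Int.floor_eq_zero_iff, Set.mem_Ico, le_div_iff₀ (by positivity),
      div_lt_iff₀ (by positivity)]
    split_ifs <;> constructor <;> linarith
  rw [hpos, Int.floor_eq_zero_iff, ← add_div, Set.mem_Ico, le_div_iff₀ (by positivity),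
      div_lt_iff₀ (by positivity)]
  split_ifs <;> constructor <;> linarith

lemma exists_Icc_subset_adjacentGrid_cell (b : Fin n → ℝ) (hl : 0 < l) (hr : 0 < r) (hrl : r ≤ l)
    (hx : x ∈ Set.Icc c fun i => c i + r) :
    ∃ s k, 3 * l / 2 ^ k ≤ 6 * r ∧
      Set.Icc c (fun i => c i + r) ⊆ (adjacentGrid b hl s).cell k x := by
  obtain ⟨k, hk, hk'⟩ := exists_nat_pow_near_of_lt_one (div_pos hr hl) ((div_le_one hl).2 hrl)
    one_half_pos one_half_lt_one
  have hk₁ : 3 * l / 2 ^ k ≤ 6 * r := by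
    rw [one_div, inv_pow, lt_div_iff₀ hl, inv_mul_lt_iff₀ (by positivity), pow_succ] at hk
    rw [div_le_iff₀ (by positivity)]
    linarith
  have hk₂ : r / (3 * l / 2 ^ k) ≤ 1 / 3 := by
    rw [one_div, inv_pow, div_le_iff₀ hl, ← div_eq_inv_mul] at hk'
    rw [div_le_iff₀ (by positivity)]
    linarith [mul_div_assoc 3 l (2 ^ k)]
  have hs : ∀ i, ∃ t : Bool,
      ⌊(c i - (b i - 3 * l / 2 + if t then l else 0)) / (3 * l / 2 ^ k) + r / (3 * l / 2 ^ k)⌋ =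
        ⌊(c i - (b i - 3 * l / 2 + if t then l else 0)) / (3 * l / 2 ^ k)⌋ := by
    intro i
    obtain h | h := floor_add_eq_or_floor_sub_add_eq k ((c i - (b i - 3 * l / 2)) / (3 * l / 2 ^ k))
      (by positivity) hk₂
    · exact ⟨false, by simpa using h⟩
    · refine ⟨true, ?_⟩
      have hshift : l / (3 * l / 2 ^ k) = 2 ^ k / 3 := by field_simp
      rwa [if_pos rfl, ← sub_sub, sub_div, hshift]
  choose s hs using hs
  exact ⟨s, k, hk₁, Icc_subset_grid_cell _ hs hx⟩

lemma exists_setLIntegral_Icc_le (hl : 0 < l) (hr : 0 < r) {u : (Fin n → ℝ) → ℝ≥0∞}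
    (hu : Function.support u ⊆ Set.Icc b fun i => b i + l) (hxb : x ∈ Set.Icc b fun i => b i + l)
    (hxc : x ∈ Set.Icc c fun i => c i + r) :
    ∃ s k, 3 * l / 2 ^ k ≤ 6 * r ∧
      ∫⁻ y in Set.Icc c (fun i => c i + r), u y ≤ ∫⁻ y in (adjacentGrid b hl s).cell k x, u y := by
  rcases le_total r l with hrl | hlr
  · obtain ⟨s, k, hk, hsub⟩ := exists_Icc_subset_adjacentGrid_cell b hl hr hrl hxc
    exact ⟨s, k, hk, lintegral_mono_set hsub⟩
  · refine ⟨fun _ => false, 0, by linarith, ?_⟩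
    calc ∫⁻ y in Set.Icc c (fun i => c i + r), u y ≤ ∫⁻ y, u y := setLIntegral_le_lintegral _ _
      _ = ∫⁻ y in Set.Icc b (fun i => b i + l), u y := by
          rw [← lintegral_indicator measurableSet_Icc, Set.indicator_eq_self.2 hu]
      _ ≤ _ := lintegral_mono_set (Icc_subset_adjacentGrid_cell_zero hl _ hxb)

lemma setLIntegral_Icc_div_volume_le (hL : 0 < L) (hr : 0 < r) {k : ℕ} (hk : L / 2 ^ k ≤ 6 * r)
    {u : (Fin n → ℝ) → ℝ≥0∞}
    (hu : ∫⁻ y in Set.Icc c (fun i => c i + r), u y ≤ ∫⁻ y in (grid a hL).cell k x, u y) :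
    (∫⁻ y in Set.Icc c (fun i => c i + r), u y) / volume (Set.Icc c fun i => c i + r) ≤
      6 ^ n * (grid a hL).avg k u x := by
  rw [volume_Icc_add, ENNReal.div_le_iff (pow_ne_zero _ (ENNReal.ofReal_pos.2 hr).ne')
    (ENNReal.pow_ne_top ENNReal.ofReal_ne_top)]
  calc ∫⁻ y in Set.Icc c (fun i => c i + r), u y
      ≤ (grid a hL).avg k u x * ENNReal.ofReal (L / 2 ^ k) ^ n := by
        rwa [← volume_grid_cell a hL k x, NestedPartition.avg_mul_measure]
    _ ≤ (grid a hL).avg k u x * ENNReal.ofReal (6 * r) ^ n :=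
        mul_le_mul_right (pow_le_pow_left' (ENNReal.ofReal_le_ofReal hk) n) _
    _ = 6 ^ n * (grid a hL).avg k u x * ENNReal.ofReal r ^ n := by
        rw [ENNReal.ofReal_mul (by norm_num), mul_pow, ENNReal.ofReal_ofNat]
        ring

section Maximal

variable {ε : Type*} [ENorm ε] {q : ℝ}

lemma maximal_le_iSup_maximalFn (hl : 0 < l) {f : (Fin n → ℝ) → ε}
    (hf : Function.support (fun y => ‖f y‖ₑ) ⊆ Set.Icc b fun i => b i + l)
    (hx : x ∈ Set.Icc b fun i => b i + l) :
    maximal f x ≤ 6 ^ n * ⨆ s, (adjacentGrid b hl s).maximalFn (fun y => ‖f y‖ₑ) x := by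
  refine iSup_le fun P => iSup₂_le ?_
  rintro ⟨c, r, hr, rfl⟩ hxP
  obtain ⟨s, k, hk, hint⟩ := exists_setLIntegral_Icc_le hl hr hf hx hxP
  refine (setLIntegral_Icc_div_volume_le _ hr hk hint).trans (mul_le_mul_right ?_ _)
  exact le_iSup_of_le s (le_iSup (fun k => (adjacentGrid b hl s).avg k _ x) k)

lemma vectorMaximal_rpow_le (hq : 0 < q) (hl : 0 < l) {f : ℕ → (Fin n → ℝ) → ε}
    (hf : ∀ j, Function.support (fun y => ‖f j y‖ₑ) ⊆ Set.Icc b fun i => b i + l)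
    (hx : x ∈ Set.Icc b fun i => b i + l) :
    vectorMaximal q f x ^ q ≤
      (6 ^ n) ^ q * ∑ s, (adjacentGrid b hl s).vecMaximalFn q (fun j y => ‖f j y‖ₑ) x := by
  rw [vectorMaximal, ← ENNReal.rpow_mul, one_div_mul_cancel hq.ne', ENNReal.rpow_one]
  simp only [NestedPartition.vecMaximalFn]
  rw [← Summable.tsum_finsetSum fun _ _ => ENNReal.summable, ← ENNReal.tsum_mul_left]
  refine ENNReal.tsum_le_tsum fun j => ?_
  refine (ENNReal.rpow_le_rpow (maximal_le_iSup_maximalFn hl (hf j) hx) hq.le).trans ?_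
  rw [ENNReal.mul_rpow_of_nonneg _ _ hq.le]
  refine mul_le_mul_right (((ENNReal.orderIsoRpow q hq).map_iSup _).trans_le ?_) _
  exact iSup_le fun s => Finset.single_le_sum
    (f := fun s => (adjacentGrid b hl s).maximalFn (fun y => ‖f j y‖ₑ) x ^ q)
    (fun _ _ => zero_le) (Finset.mem_univ s)

lemma exists_lt_vecMaximalFn (hq : 0 < q) (hl : 0 < l) {f : ℕ → (Fin n → ℝ) → ε}
    (hf : ∀ j, Function.support (fun y => ‖f j y‖ₑ) ⊆ Set.Icc b fun i => b i + l)
    (hx : x ∈ Set.Icc b fun i => b i + l) {M : ℝ≥0∞}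
    (hM : (6 ^ n) ^ q * (2 ^ n * M) < vectorMaximal q f x ^ q) :
    ∃ s, M < (adjacentGrid b hl s).vecMaximalFn q (fun j y => ‖f j y‖ₑ) x := by
  by_contra! hle
  refine hM.not_ge ((vectorMaximal_rpow_le hq hl hf hx).trans (mul_le_mul_right ?_ _))
  simpa using Finset.sum_le_card_nsmul Finset.univ _ M fun s _ => hle s

/-- The number `A` such that every increase of `t ^ q` by `A` halves the bound for the measure of
the set where `vectorMaximal q f` exceeds `t` times the maximal function of `lqNorm q f`. -/
def halvingConst (n : ℕ) (q : ℝ) : ℝ≥0∞ :=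
  (6 ^ n) ^ q * (2 ^ n * NestedPartition.decayConst q (2 ^ n))

lemma halvingConst_ne_zero (n : ℕ) (hq : 1 < q) : halvingConst n q ≠ 0 := by
  have hq0 : ¬ q < 0 := by linarith
  simp [halvingConst, ENNReal.rpow_eq_zero_iff, NestedPartition.decayConst_ne_zero hq, hq0]

lemma halvingConst_ne_top (n : ℕ) (hq : 1 < q) : halvingConst n q ≠ ∞ :=
  ENNReal.mul_ne_top
    (ENNReal.rpow_ne_top_of_nonneg (by linarith) (ENNReal.pow_ne_top ENNReal.ofNat_ne_top))
    (ENNReal.mul_ne_top (ENNReal.pow_ne_top ENNReal.ofNat_ne_top)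
      (NestedPartition.decayConst_ne_top hq))

lemma measure_lt_vectorMaximal_le (hq : 1 < q) {Q : Set (Fin n → ℝ)} (hQ : IsCube Q)
    {f : ℕ → (Fin n → ℝ) → ε} (hfm : ∀ j, AEMeasurable (fun y => ‖f j y‖ₑ) volume)
    (hf : ∀ j, Function.support (fun y => ‖f j y‖ₑ) ⊆ Q) {t : ℝ≥0∞} (m : ℕ)
    (hm : halvingConst n q * m ≤ t ^ q) :
    volume {x ∈ Q | t * maximal (lqNorm q f) x < vectorMaximal q f x} ≤
      6 ^ n * 2⁻¹ ^ m * volume Q := by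
  have hq0 : 0 < q := by linarith
  obtain ⟨b, l, hl, rfl⟩ := hQ
  set H := maximal (lqNorm q f)
  set Λ := NestedPartition.decayConst q (2 ^ n)
  set B : (Fin n → Bool) → Set (Fin n → ℝ) := fun s => (adjacentGrid b hl s).cell 0 b ∩
    {x | m * Λ * H x ^ q < (adjacentGrid b hl s).vecMaximalFn q (fun j y => ‖f j y‖ₑ) x}
  have hb : b ∈ Set.Icc b fun i => b i + l := ⟨le_rfl, fun i => le_add_of_nonneg_right hl.le⟩
  have hsub : {x ∈ Set.Icc b (fun i => b i + l) | t * H x < vectorMaximal q f x} ⊆ ⋃ s, B s := by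
    rintro x ⟨hxQ, hx⟩
    have hlt : (6 ^ n) ^ q * (2 ^ n * (m * Λ * H x ^ q)) < vectorMaximal q f x ^ q :=
      calc (6 ^ n) ^ q * (2 ^ n * (m * Λ * H x ^ q)) = halvingConst n q * m * H x ^ q := by
            rw [halvingConst]; ring
        _ ≤ t ^ q * H x ^ q := mul_le_mul_left hm _
        _ = (t * H x) ^ q := (ENNReal.mul_rpow_of_nonneg _ _ hq0.le).symm
        _ < vectorMaximal q f x ^ q := ENNReal.rpow_lt_rpow hx hq0
    obtain ⟨s, hs⟩ := exists_lt_vecMaximalFn hq0 hl hf hxQ hlt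
    exact Set.mem_iUnion.2 ⟨s, Icc_subset_adjacentGrid_cell_zero hl s hb hxQ, hs⟩
  have hB : ∀ s, volume (B s) ≤ 2⁻¹ ^ m * ENNReal.ofReal (3 * l) ^ n := fun s => by
    refine (NestedPartition.measure_lt_vecMaximalFn_le hq hfm (fun i x => ?_) m b).trans_eq ?_
    · exact avg_grid_le_maximal (lqNorm q f) _ _ i x
    · rw [adjacentGrid, volume_grid_cell, pow_zero, div_one]
  calc volume {x ∈ Set.Icc b (fun i => b i + l) | t * H x < vectorMaximal q f x}
      ≤ ∑ s, volume (B s) := (measure_mono hsub).trans (measure_iUnion_fintype_le _ _)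
    _ ≤ 2 ^ n * (2⁻¹ ^ m * ENNReal.ofReal (3 * l) ^ n) := by
        simpa using Finset.sum_le_card_nsmul Finset.univ _ _ fun s _ => hB s
    _ = 6 ^ n * 2⁻¹ ^ m * volume (Set.Icc b fun i => b i + l) := by
        rw [volume_Icc_add, ENNReal.ofReal_mul zero_le_three, ENNReal.ofReal_ofNat, mul_pow,
          show (6 : ℝ≥0∞) = 2 * 3 by norm_num, mul_pow]
        ring

end Maximal

lemma half_pow_floor_le (s : ℝ) : (1 / 2 : ℝ) ^ ⌊s⌋₊ ≤ 2 * Real.exp (-Real.log 2 * s) := by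
  calc (1 / 2 : ℝ) ^ ⌊s⌋₊ = 2 * Real.exp (-Real.log 2 * (⌊s⌋₊ + 1)) := by
        rw [Real.exp_mul, Real.exp_neg, Real.exp_log two_pos, ← Nat.cast_add_one,
          Real.rpow_natCast, pow_succ, one_div]
        ring
    _ ≤ 2 * Real.exp (-Real.log 2 * s) := by
        have hlog : 0 ≤ Real.log 2 := Real.log_nonneg one_le_two
        have hs : s ≤ ⌊s⌋₊ + 1 := (Nat.lt_floor_add_one s).le
        exact mul_le_mul_of_nonneg_left (Real.exp_le_exp.2
          (mul_le_mul_of_nonpos_left hs (neg_nonpos.2 hlog))) zero_le_two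

end HardyLittlewood

end

open HardyLittlewood in
theorem theorem2p5_general (n : ℕ) {q : ℝ} (hq : 1 < q) :
    ∃ α c : ℝ, 0 < α ∧ 0 < c ∧
      ∀ {ε : Type*} [ENorm ε] (Q : Set (Fin n → ℝ)), IsCube Q →
      ∀ f : ℕ → (Fin n → ℝ) → ε, (∀ j, AEMeasurable (fun x => ‖f j x‖ₑ) volume) →
        (∀ j, Function.support (fun x => ‖f j x‖ₑ) ⊆ Q) →
      ∀ t : ℝ, 0 < t →
        volume {x ∈ Q | ENNReal.ofReal t * maximal (lqNorm q f) x < vectorMaximal q f x} ≤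
          ENNReal.ofReal (c * Real.exp (-α * t ^ q)) * volume Q := by
  set A := (halvingConst n q).toReal
  have hA : ENNReal.ofReal A = halvingConst n q :=
    ENNReal.ofReal_toReal (halvingConst_ne_top n hq)
  have hA0 : 0 < A :=
    ENNReal.toReal_pos (halvingConst_ne_zero n hq) (halvingConst_ne_top n hq)
  refine ⟨Real.log 2 / A, 6 ^ n * 2, by positivity, by positivity, fun Q hQ f hfm hf t ht => ?_⟩
  have hfloor : halvingConst n q * ⌊t ^ q / A⌋₊ ≤ ENNReal.ofReal t ^ q := by
    rw [← hA, ← ENNReal.ofReal_natCast, ← ENNReal.ofReal_mul hA0.le, ENNReal.ofReal_rpow_of_pos ht]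
    exact ENNReal.ofReal_le_ofReal ((le_div_iff₀' hA0).1 (Nat.floor_le (by positivity)))
  refine (measure_lt_vectorMaximal_le hq hQ hfm hf _ hfloor).trans (mul_le_mul_left ?_ _)
  calc (6 : ℝ≥0∞) ^ n * 2⁻¹ ^ ⌊t ^ q / A⌋₊
      = ENNReal.ofReal (6 ^ n * (1 / 2) ^ ⌊t ^ q / A⌋₊) := by
        simp [ENNReal.ofReal_mul, ENNReal.ofReal_pow, ENNReal.ofReal_inv_of_pos, ENNReal.inv_pow]
    _ ≤ ENNReal.ofReal (6 ^ n * 2 * Real.exp (-(Real.log 2 / A) * t ^ q)) := by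
        rw [mul_assoc, neg_div', div_mul_eq_mul_div, mul_div_assoc]
        exact ENNReal.ofReal_le_ofReal
          (mul_le_mul_of_nonneg_left (half_pow_floor_le _) (by positivity))

theorem theorem2p5 (n : ℕ) (hn : 1 ≤ n) (q : ℝ) (hq : 1 < q) :
    ∃ α c : ℝ, 0 < α ∧ 0 < c ∧
      ∀ Q : Set (Fin n → ℝ), HardyLittlewood.IsCube Q →
      ∀ f : ℕ → (Fin n → ℝ) → ℂ, (∀ j, AEMeasurable (f j) volume) →
        (∀ j, Function.support (f j) ⊆ Q) →
      ∀ t : ℝ, 0 < t →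
        volume {x ∈ Q | ENNReal.ofReal t *
            HardyLittlewood.maximal (HardyLittlewood.lqNorm q f) x
              < HardyLittlewood.vectorMaximal q f x}
          ≤ ENNReal.ofReal (c * Real.exp (-α * t ^ q)) * volume Q := by
  obtain ⟨α, c, hα, hc, h⟩ := theorem2p5_general n hq
  exact ⟨α, c, hα, hc, fun Q hQ f hfm hf => h Q hQ f (fun j => (hfm j).enorm) fun j _ hx =>
    hf j (enorm_ne_zero.1 hx)⟩
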